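/- All Hilbert spaces are complex and separable. Let $\mathcal E,\mathcal E_*$ be Hilbert spaces, and let $\Theta:\mathbb D\to\mathcal B(\mathcal E,\mathcal E_*)$ be an analytic function on the open unit disc such that $\|\Theta(z)a\|\le\|a\|$ for all $z\in\mathbb D$, $a\in\mathcal E$, and $\|\Theta(0)a\|<\|a\|$ for all $a\neq0$ (that is, $\Theta$ is purely contractive). Assume that $\Theta$ is inner, i.e. for almost every $t$ the strong radial limit $\Theta(e^{it})$ exists and is an isometry from $\mathcal E$ to $\mathcal E_*$, and that \[ \Theta(z)=\sum_{m=1}^{\infty}\theta_m z^m\qquad(z\in\mathbb D), \] where every $\theta_m\in\mathcal B(\mathcal E,\mathcal E_*)$, $m\ge1$, is a partial isometry. (An operator is a partial isometry if it is isometric on the orthogonal complement of its kernel.) Let $H^2_{\mathcal E}(\mathbb D)=\{\sum_{m\ge0}a_mz^m: a_m\in\mathcal E,\ \sum\|a_m\|^2<\infty\}$, identified with a closed subspace of the space $L^2_{\mathcal E}$ of square integrable $\mathcal E$-valued functions on the circle through $\sum a_mz^m\mapsto\sum a_me^{imt}$; similarly for $\mathcal E_*$. Let $T_\Theta:H^2_{\mathcal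 E}(\mathbb D)\to H^2_{\mathcal E_*}(\mathbb D)$, $T_\Theta h=P_+(\Theta h)$, be the Toeplitz operator with symbol $\Theta(e^{it})$, where $P_+$ is the orthogonal projection of $L^2_{\mathcal E_*}$ onto $H^2_{\mathcal E_*}(\mathbb D)$. Then \[ \mathcal H=\{(I-T_\Theta T_\Theta^*)f:\ f\in H^2_{\mathcal E_*}(\mathbb D)\} \] is a Hilbert space (a closed subspace of $H^2_{\mathcal E_*}(\mathbb D)$), and there is a bounded operator $T$ on $\mathcal H$ with \[ (T^*u)(e^{it})=e^{-it}\bigl(u(e^{it})-u(0)\bigr)\qquad(u\in\mathcal H). \] Moreover $T$ is a pure contraction, i.e. $\|T\|\le1$ and $\|T^{*m}h\|\to0$ for all $h\in\mathcal H$; it is a power partial isometry, i.e. $T^n$ is a partial isometry for every $n\ge1$; and its characteristic function coincides with $\Theta$. Here, with $D_T=(I-T^*T)^{1/2}$, $D_{T^*}=(I-TT^*)^{1/2}$, $\mathcal D_T=\overline{\operatorname{ran}D_T}$ and $\mathcal D_{T^*}=\overline{\operatorname{ran}D_{T^*}}$, the characteristic function of $T$ is \[ \Theta_T(z)=\bigl[-T+zD_{T^*}(I-zT^*)^{-1}D_T\bigr]\big|_{\mathcal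 D_T}:\mathcal D_T\to\mathcal D_{T^*}\qquad(z\in\mathbb D), \] and "coincides" means that there are unitary operators $\tau:\mathcal D_T\to\mathcal E$ and $\tau_*:\mathcal D_{T^*}\to\mathcal E_*$ with $\tau_*\Theta_T(z)=\Theta(z)\tau$ for all $z\in\mathbb D$. -/

import Mathlib

open MeasureTheory Filter Topology
open scoped ENNReal InnerProductSpace

namespace PowerPartialIsometry

noncomputable section

/-! ### Operators on Hilbert spaces -/

/-- A partial isometry: an operator that is isometric on the orthogonal complement of its
kernel. -/
def IsPartialIsometry {E F : Type*} [NormedAddCommGroup E] [InnerProductSpace ℂ E]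
    [NormedAddCommGroup F] [InnerProductSpace ℂ F] (T : E →L[ℂ] F) : Prop :=
  ∀ h ∈ (LinearMap.ker (T : E →ₗ[ℂ] F))ᗮ, ‖T h‖ = ‖h‖

/-- A power partial isometry: every positive power is a partial isometry. -/
def IsPowerPartialIsometry {H : Type*} [NormedAddCommGroup H] [InnerProductSpace ℂ H]
    (T : H →L[ℂ] H) : Prop :=
  ∀ n : ℕ, 1 ≤ n → IsPartialIsometry (T ^ n)

/-- A pure contraction: `‖T*ᵐ h‖ → 0` for every `h`. -/
def IsPure {H : Type*} [NormedAddCommGroup H] [InnerProductSpace ℂ H] [CompleteSpace H]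
    (T : H →L[ℂ] H) : Prop :=
  ‖T‖ ≤ 1 ∧ ∀ h : H, Tendsto (fun m : ℕ => ‖((ContinuousLinearMap.adjoint T) ^ m) h‖) atTop (𝓝 0)

/-! ### The characteristic function of a contraction -/

section CharacteristicFunction

variable {H : Type*} [NormedAddCommGroup H] [InnerProductSpace ℂ H] [CompleteSpace H]

/-- The defect operator `D_T = (I - T* T)^{1/2}`. -/
def defectOp (T : H →L[ℂ] H) : H →L[ℂ] H :=
  CFC.sqrt (1 - ContinuousLinearMap.adjoint T * T)

/-- The defect space `𝒟_T`, the closure of the range of `D_T`. -/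
def defectSpace (T : H →L[ℂ] H) : Submodule ℂ H :=
  (LinearMap.range (defectOp T : H →ₗ[ℂ] H)).topologicalClosure

/-- The operator `-T + z D_{T*} (I - z T*)⁻¹ D_T` on the whole space. -/
def charOp (T : H →L[ℂ] H) (z : ℂ) : H →L[ℂ] H :=
  -T + z • (defectOp (ContinuousLinearMap.adjoint T) *
    Ring.inverse (1 - z • ContinuousLinearMap.adjoint T) * defectOp T)

theorem one_sub_adjoint_mul_self_nonneg {T : H →L[ℂ] H} (hT : ‖T‖ ≤ 1) :
    0 ≤ 1 - ContinuousLinearMap.adjoint T * T := by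
  have h := CStarAlgebra.star_mul_le_algebraMap_norm_sq (a := T)
  rw [ContinuousLinearMap.star_eq_adjoint] at h
  refine sub_nonneg.2 (h.trans ?_)
  rw [← map_one (algebraMap ℝ (H →L[ℂ] H))]
  exact algebraMap_mono _ (by nlinarith [norm_nonneg T])

theorem defectOp_mul_self {T : H →L[ℂ] H} (hT : ‖T‖ ≤ 1) :
    defectOp T * defectOp T = 1 - ContinuousLinearMap.adjoint T * T :=
  CFC.sqrt_mul_sqrt_self _ (one_sub_adjoint_mul_self_nonneg hT)

theorem defectOp_isSelfAdjoint (T : H →L[ℂ] H) : IsSelfAdjoint (defectOp T) :=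
  IsSelfAdjoint.of_nonneg (CFC.sqrt_nonneg _)

theorem inner_defectOp (T : H →L[ℂ] H) (x y : H) :
    ⟪defectOp T x, y⟫_ℂ = ⟪x, defectOp T y⟫_ℂ := by
  have h := (ContinuousLinearMap.isSelfAdjoint_iff'.1 (defectOp_isSelfAdjoint T))
  conv_lhs => rw [← h]
  exact ContinuousLinearMap.adjoint_inner_left _ _ _

theorem norm_sq_defectOp {T : H →L[ℂ] H} (hT : ‖T‖ ≤ 1) (x : H) :
    ⟪defectOp T x, defectOp T x⟫_ℂ = ⟪x, x - ContinuousLinearMap.adjoint T (T x)⟫_ℂ := by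
  rw [inner_defectOp]
  have := congrArg (fun A : H →L[ℂ] H => A x) (defectOp_mul_self hT)
  simp only [mul_apply_eq_comp, sub_apply,
    one_apply_eq_self] at this
  rw [this]

/-- A contraction maps the range of `D_T` into `𝒟_{T*}`. -/
theorem apply_defectOp_mem {T : H →L[ℂ] H} (hT : ‖T‖ ≤ 1) (h : H) :
    T (defectOp T h) ∈ defectSpace (ContinuousLinearMap.adjoint T) := by
  have hT' : ‖ContinuousLinearMap.adjoint T‖ ≤ 1 := by
    rwa [LinearIsometryEquiv.norm_map]
  unfold defectSpace
  rw [← Submodule.orthogonal_orthogonal_eq_closure, Submodule.mem_orthogonal]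
  intro k hk
  have hk0 : defectOp (ContinuousLinearMap.adjoint T) k = 0 := by
    have h1 := (Submodule.mem_orthogonal _ _).1 hk
      (defectOp (ContinuousLinearMap.adjoint T)
        (defectOp (ContinuousLinearMap.adjoint T) k)) ⟨_, rfl⟩
    rw [inner_defectOp] at h1
    exact inner_self_eq_zero.1 h1
  have hk1 : k - T (ContinuousLinearMap.adjoint T k) = 0 := by
    have := congrArg (fun A : H →L[ℂ] H => A k) (defectOp_mul_self hT')
    simp only [mul_apply_eq_comp, sub_apply,
      one_apply_eq_self, hk0, map_zero,
      ContinuousLinearMap.adjoint_adjoint] at this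
    exact this.symm
  have hk2 : defectOp T (ContinuousLinearMap.adjoint T k) = 0 := by
    rw [← inner_self_eq_zero (𝕜 := ℂ), norm_sq_defectOp hT, ← map_sub, hk1, map_zero,
      inner_zero_right]
  rw [← ContinuousLinearMap.adjoint_inner_left, ← inner_defectOp, hk2, inner_zero_left]

theorem charOp_mem {T : H →L[ℂ] H} (hT : ‖T‖ ≤ 1) (z : ℂ) (h : defectSpace T) :
    charOp T z h ∈ defectSpace (ContinuousLinearMap.adjoint T) := by
  have h1 : T (h : H) ∈ defectSpace (ContinuousLinearMap.adjoint T) := by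
    have hcl : IsClosed ((defectSpace (ContinuousLinearMap.adjoint T) : Submodule ℂ H) : Set H) :=
      Submodule.isClosed_topologicalClosure _
    have hh : (h : H) ∈ closure ((LinearMap.range (defectOp T : H →ₗ[ℂ] H) : Submodule ℂ H) :
        Set H) := h.2
    refine (closure_minimal ?_ (hcl.preimage T.continuous)) hh
    rintro _ ⟨x, rfl⟩
    exact apply_defectOp_mem hT x
  refine Submodule.add_mem _ (Submodule.neg_mem _ h1) (Submodule.smul_mem _ _ ?_)
  exact Submodule.le_topologicalClosure _ ⟨_, rfl⟩

/-- The characteristic function `Θ_T(z) = [-T + z D_{T*} (I - z T*)⁻¹ D_T]|_{𝒟_T}` of a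
contraction `T`, with values in the operators from `𝒟_T` to `𝒟_{T*}`. Only its values for
`‖z‖ < 1`, where the inverse exists, are meaningful. -/
def charFun (T : H →L[ℂ] H) (hT : ‖T‖ ≤ 1) (z : ℂ) :
    defectSpace T →L[ℂ] defectSpace (ContinuousLinearMap.adjoint T) :=
  ((charOp T z).comp (defectSpace T).subtypeL).codRestrict _ (charOp_mem hT z)

end CharacteristicFunction

/-! ### Contractive analytic functions on the unit disc -/

section AnalyticFunctions

variable {E F : Type*} [NormedAddCommGroup E] [InnerProductSpace ℂ E]
  [NormedAddCommGroup F] [InnerProductSpace ℂ F]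

/-- Two operator-valued functions on the disc coincide if they agree up to constant unitaries. -/
def Coincide {E' F' : Type*} [NormedAddCommGroup E'] [InnerProductSpace ℂ E']
    [NormedAddCommGroup F'] [InnerProductSpace ℂ F']
    (Θ : ℂ → E →L[ℂ] F) (Φ : ℂ → E' →L[ℂ] F') : Prop :=
  ∃ (τ : E ≃ₗᵢ[ℂ] E') (τ' : F ≃ₗᵢ[ℂ] F'),
    ∀ z ∈ Metric.ball (0 : ℂ) 1, ∀ a : E, τ' (Θ z a) = Φ z (τ a)

/-- A contractive analytic function on the open unit disc. -/
structure IsContractiveAnalytic (Θ : ℂ → E →L[ℂ] F) : Prop where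
  analytic : AnalyticOnNhd ℂ Θ (Metric.ball 0 1)
  contractive : ∀ z ∈ Metric.ball (0 : ℂ) 1, ∀ a : E, ‖Θ z a‖ ≤ ‖a‖

/-- A purely contractive analytic function on the open unit disc. -/
structure IsPurelyContractive (Θ : ℂ → E →L[ℂ] F) : Prop extends IsContractiveAnalytic Θ where
  pure : ∀ a : E, a ≠ 0 → ‖Θ 0 a‖ < ‖a‖

end AnalyticFunctions

/-! ### The circle, boundary values, and inner functions -/

instance factTwoPiPos : Fact (0 < 2 * Real.pi) := ⟨Real.two_pi_pos⟩

/-- The circle, with the parameter `t ∈ ℝ / 2πℤ`; `fourier n t = e^{int}`. -/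
abbrev 𝕋 : Type := AddCircle (2 * Real.pi)

/-- Normalized Lebesgue measure on the circle. -/
abbrev σ : Measure 𝕋 := AddCircle.haarAddCircle

/-- `L²_E`, the square integrable `E`-valued functions on the circle. -/
abbrev L2 (E : Type*) [NormedAddCommGroup E] : Type _ := Lp E 2 σ

section Boundary

variable {E F : Type*} [NormedAddCommGroup E] [InnerProductSpace ℂ E]
  [NormedAddCommGroup F] [InnerProductSpace ℂ F]

/-- `V` is the strong radial limit of `Θ` at `e^{it}`. -/
def HasRadialLimit (Θ : ℂ → E →L[ℂ] F) (t : 𝕋) (V : E →L[ℂ] F) : Prop :=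
  ∀ a : E, Tendsto (fun r : ℝ => Θ ((r : ℂ) * fourier 1 t) a) (𝓝[<] 1) (𝓝 (V a))

open Classical in
/-- The boundary function `t ↦ Θ(e^{it})` (zero where the strong radial limit does not exist). -/
def boundaryValue (Θ : ℂ → E →L[ℂ] F) (t : 𝕋) : E →L[ℂ] F :=
  if h : ∃ V, HasRadialLimit Θ t V then h.choose else 0

theorem boundaryValue_spec {Θ : ℂ → E →L[ℂ] F} {t : 𝕋} (h : ∃ V, HasRadialLimit Θ t V) :
    HasRadialLimit Θ t (boundaryValue Θ t) := by
  unfold boundaryValue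
  rw [dif_pos h]
  exact h.choose_spec

/-- An inner function: a contractive analytic function whose boundary value `Θ(e^{it})` is an
isometry for almost every `t`. -/
structure IsInner (Θ : ℂ → E →L[ℂ] F) : Prop extends IsContractiveAnalytic Θ where
  isometry_ae : ∀ᵐ t ∂σ, (∃ V, HasRadialLimit Θ t V) ∧ ∀ a : E, ‖boundaryValue Θ t a‖ = ‖a‖

/-- Membership in `L^∞_{B(E, F)}`: strongly measurable and essentially bounded. -/
structure IsBoundedSymbol (Φ : 𝕋 → E →L[ℂ] F) : Prop where
  measurable : ∀ a : E, AEStronglyMeasurable (fun t => Φ t a) σ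
  bounded : ∃ C : ℝ, ∀ᵐ t ∂σ, ‖Φ t‖ ≤ C

theorem IsInner.isBoundedSymbol {Θ : ℂ → E →L[ℂ] F} (hΘ : IsInner Θ) :
    IsBoundedSymbol (boundaryValue Θ) where
  measurable a := by
    obtain ⟨u, -, hu, hlim⟩ := exists_seq_strictMono_tendsto' (show (0 : ℝ) < 1 by norm_num)
    refine aestronglyMeasurable_of_tendsto_ae atTop
      (f := fun n t => Θ ((u n : ℂ) * fourier 1 t) a) (fun n => ?_) ?_
    · have hc : Continuous (fun t : 𝕋 => Θ ((u n : ℂ) * fourier 1 t)) := by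
        refine hΘ.analytic.continuousOn.comp_continuous
          (continuous_const.mul (fourier 1).continuous) (fun t => ?_)
        have := hu n
        rw [mem_ball_zero_iff, norm_mul, fourier_apply, Circle.norm_coe, mul_one,
          Complex.norm_real, Real.norm_of_nonneg this.1.le]
        exact this.2
      exact (hc.clm_apply continuous_const).aestronglyMeasurable
    · filter_upwards [hΘ.isometry_ae] with t ht
      refine (boundaryValue_spec ht.1 a).comp ?_
      exact tendsto_nhdsWithin_iff.2 ⟨hlim, Eventually.of_forall fun n => (hu n).2⟩
  bounded := by
    refine ⟨1, ?_⟩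
    filter_upwards [hΘ.isometry_ae] with t ht
    exact ContinuousLinearMap.opNorm_le_bound _ zero_le_one fun a => by rw [ht.2 a, one_mul]

/-! ### Laurent operators -/

theorem IsBoundedSymbol.aestronglyMeasurable_apply {Φ : 𝕋 → E →L[ℂ] F} (hΦ : IsBoundedSymbol Φ)
    {h : 𝕋 → E} (hh : AEStronglyMeasurable h σ) :
    AEStronglyMeasurable (fun t => Φ t (h t)) σ := by
  obtain ⟨g, hg, hgh⟩ := hh
  have key : AEStronglyMeasurable (fun t => Φ t (g t)) σ := by
    refine aestronglyMeasurable_of_tendsto_ae atTop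
      (f := fun n t => Φ t (hg.approx n t)) (fun n => ?_)
      (Eventually.of_forall fun t => ((Φ t).continuous.tendsto _).comp (hg.tendsto_approx t))
    have : (fun t => Φ t (hg.approx n t)) = fun t =>
        ∑ y ∈ (hg.approx n).range, ((hg.approx n) ⁻¹' {y}).indicator (fun t => Φ t y) t := by
      funext t
      rw [Finset.sum_eq_single (hg.approx n t)]
      · simp
      · intro b _ hb
        exact Set.indicator_of_notMem (fun h => hb h.symm) _
      · intro hn
        exact absurd (SimpleFunc.mem_range_self _ _) hn
    rw [this]
    refine Finset.aestronglyMeasurable_fun_sum _ fun y _ => ?_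
    exact (hΦ.measurable y).indicator ((hg.approx n).measurableSet_fiber y)
  refine key.congr ?_
  filter_upwards [hgh] with t ht
  rw [ht]

theorem IsBoundedSymbol.memLp_apply {Φ : 𝕋 → E →L[ℂ] F} (hΦ : IsBoundedSymbol Φ) (h : L2 E) :
    MemLp (fun t => Φ t (h t)) 2 σ := by
  obtain ⟨C, hC⟩ := hΦ.bounded
  refine (Lp.memLp h).of_le_mul (c := C)
    (hΦ.aestronglyMeasurable_apply (Lp.aestronglyMeasurable h)) ?_
  filter_upwards [hC] with t ht
  exact (Φ t).le_of_opNorm_le ht _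

/-- The Laurent operator `L_Φ h = Φ h` from `L²_E` to `L²_F`. -/
def laurent (Φ : 𝕋 → E →L[ℂ] F) (hΦ : IsBoundedSymbol Φ) : L2 E →L[ℂ] L2 F :=
  LinearMap.mkContinuousOfExistsBound
    { toFun := fun h => (hΦ.memLp_apply h).toLp
      map_add' := fun f g => by
        apply Lp.ext
        filter_upwards [(hΦ.memLp_apply (f + g)).coeFn_toLp, (hΦ.memLp_apply f).coeFn_toLp,
          (hΦ.memLp_apply g).coeFn_toLp, Lp.coeFn_add f g,
          Lp.coeFn_add (hΦ.memLp_apply f).toLp (hΦ.memLp_apply g).toLp] with t h1 h2 h3 h4 h5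
        rw [h1, h5, Pi.add_apply, h2, h3, h4, Pi.add_apply, map_add]
      map_smul' := fun c f => by
        apply Lp.ext
        filter_upwards [(hΦ.memLp_apply (c • f)).coeFn_toLp, (hΦ.memLp_apply f).coeFn_toLp,
          Lp.coeFn_smul c f, Lp.coeFn_smul c (hΦ.memLp_apply f).toLp] with t h1 h2 h3 h4
        rw [RingHom.id_apply, h1, h4, Pi.smul_apply, h2, h3, Pi.smul_apply, map_smul] }
    (by
      obtain ⟨C, hC⟩ := hΦ.bounded
      refine ⟨C, fun f => Lp.norm_le_mul_norm_of_ae_le_mul ?_⟩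
      filter_upwards [hC, (hΦ.memLp_apply f).coeFn_toLp] with t ht h1
      simp only [LinearMap.coe_mk, AddHom.coe_mk]
      rw [h1]
      exact (Φ t).le_of_opNorm_le ht _)

theorem laurent_ae {Φ : 𝕋 → E →L[ℂ] F} (hΦ : IsBoundedSymbol Φ) (h : L2 E) :
    laurent Φ hΦ h =ᵐ[σ] fun t => Φ t (h t) :=
  (hΦ.memLp_apply h).coeFn_toLp

end Boundary

/-! ### Hardy spaces and Toeplitz operators -/

section Hardy

/-- The Hardy space `H²_E(𝔻)`: the power series `∑ aₘ zᵐ` with `∑ ‖aₘ‖² < ∞`, given by their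
coefficients; for `f : HardySpace E` the coefficient of `zᵐ` is `f m`. -/
abbrev HardySpace (E : Type*) [NormedAddCommGroup E] : Type _ := lp (fun _ : ℕ => E) 2

variable {E F : Type*} [NormedAddCommGroup E] [InnerProductSpace ℂ E]
  [NormedAddCommGroup F] [InnerProductSpace ℂ F]

theorem memLp_monomial (n : ℕ) (a : E) : MemLp (fun t : 𝕋 => fourier (n : ℤ) t • a) 2 σ := by
  refine MemLp.of_bound (C := ‖a‖)
    (((fourier (n : ℤ)).continuous.smul continuous_const).aestronglyMeasurable) ?_
  refine Eventually.of_forall fun t => ?_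
  rw [norm_smul, fourier_apply, Circle.norm_coe, one_mul]

theorem inner_monomial (m n : ℕ) (a b : E) :
    ⟪((memLp_monomial m a).toLp : L2 E), (memLp_monomial n b).toLp⟫_ℂ =
      if m = n then ⟪a, b⟫_ℂ else 0 := by
  have h1 : ⟪((memLp_monomial m a).toLp : L2 E), (memLp_monomial n b).toLp⟫_ℂ =
      ∫ t : 𝕋, (starRingEnd ℂ (fourier (m : ℤ) t) * fourier (n : ℤ) t) * ⟪a, b⟫_ℂ ∂σ := by
    rw [L2.inner_def]
    refine integral_congr_ae ?_
    filter_upwards [(memLp_monomial m a).coeFn_toLp, (memLp_monomial n b).coeFn_toLp]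
      with t h2 h3
    rw [h2, h3, inner_smul_left, inner_smul_right, mul_assoc]
  have h2 := (orthonormal_iff_ite.1 (orthonormal_fourier (T := 2 * Real.pi))) m n
  rw [ContinuousMap.inner_toLp] at h2
  rw [h1, integral_mul_const]
  have h3 : (∫ t : 𝕋, starRingEnd ℂ (fourier (m : ℤ) t) * fourier (n : ℤ) t ∂σ) =
      if (m : ℤ) = n then 1 else 0 := by
    rw [← h2]
    exact integral_congr_ae (Eventually.of_forall fun t => mul_comm _ _)
  rw [h3]
  by_cases hmn : m = n <;> simp [hmn]

/-- The function `t ↦ e^{int} a` in `L²_E`, as an isometric function of `a`. -/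
def monomial (n : ℕ) : E →ₗᵢ[ℂ] L2 E where
  toFun a := (memLp_monomial n a).toLp
  map_add' a b := by
    rw [← MemLp.toLp_add]
    congr 1
    funext t
    simp
  map_smul' c a := by
    rw [RingHom.id_apply, ← MemLp.toLp_const_smul]
    congr 1
    funext t
    simp [smul_comm c]
  norm_map' a := by
    have h := inner_monomial n n a a
    rw [if_pos rfl, inner_self_eq_norm_sq_to_K, inner_self_eq_norm_sq_to_K] at h
    have h' : ‖((memLp_monomial n a).toLp : L2 E)‖ ^ 2 = ‖a‖ ^ 2 := by exact_mod_cast h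
    exact (pow_left_inj₀ (norm_nonneg _) (norm_nonneg _) two_ne_zero).1 h'

theorem orthogonalFamily_monomial :
    OrthogonalFamily ℂ (fun _ : ℕ => E) (fun n => monomial (E := E) n) := by
  intro m n hmn a b
  exact (inner_monomial m n a b).trans (if_neg hmn)

variable [CompleteSpace E] [CompleteSpace F]

/-- The identification of the Hardy space with a closed subspace of `L²_E`: the power series
`∑ aₘ zᵐ` has the boundary function `∑ aₘ e^{imt}` (convergence in `L²_E`). -/
def boundary : HardySpace E →ₗᵢ[ℂ] L2 E :=
  (orthogonalFamily_monomial (E := E)).linearIsometry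

/-- The orthogonal projection `P₊` of `L²_E` onto the Hardy space, that is, the adjoint of the
isometric inclusion. -/
def hardyProj : L2 E →L[ℂ] HardySpace E :=
  ContinuousLinearMap.adjoint (boundary (E := E)).toContinuousLinearMap

/-- The Toeplitz operator `T_Φ h = P₊ (Φ h)` from `H²_E` to `H²_F`. -/
def toeplitz (Φ : 𝕋 → E →L[ℂ] F) (hΦ : IsBoundedSymbol Φ) : HardySpace E →L[ℂ] HardySpace F :=
  hardyProj ∘L laurent Φ hΦ ∘L (boundary (E := E)).toContinuousLinearMap

/-- The space `{(I - T_Θ T_Θ*) f : f ∈ H²_F}` for an inner function `Θ`. -/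
def modelSpace (Θ : ℂ → E →L[ℂ] F) (hΘ : IsInner Θ) : Submodule ℂ (HardySpace F) :=
  LinearMap.range ((1 - toeplitz (boundaryValue Θ) hΘ.isBoundedSymbol ∘L
    ContinuousLinearMap.adjoint (toeplitz (boundaryValue Θ) hΘ.isBoundedSymbol) :
      HardySpace F →L[ℂ] HardySpace F) : HardySpace F →ₗ[ℂ] HardySpace F)

end Hardy

end

end PowerPartialIsometry

/-! Since `Θ` is inner, `M = T_Θ` is an isometric multiplication operator, so `1 - M M*` is the
projection onto `ker M*`. The model space is therefore the set of `u` orthogonal to every `zⁿ Θ a`.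

The partial isometries enter through one identity: `‖Θ a‖ = ‖a‖` in `H²` reads `∑ ‖θₘ a‖² = ‖a‖²`.
If `a` is orthogonal to `ker θⱼ`, the `j`-th term already exhausts the sum, so every other
coefficient kills `a` (`IsIsometricMultiplication.apply_eq_zero`). Testing orthogonality on such `a`
leaves a single term, and membership in the model space becomes a separate condition on each
coefficient of `u` (`IsIsometricMultiplication.adjoint_eq_zero_iff`). Hence the space is stable
under deleting low coefficients.

Let `T*` be the backward shift `B` restricted to the model space. By this stability `Tⁿ T*ⁿ` is the
deletion of the first `n` coefficients (`pow_adjoint_pow_apply_coe`), a projection, so `Tⁿ` is a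
partial isometry. Purity holds because `‖Bᵐ f‖²` is the tail of a convergent series.

Both defect operators are now projections. `D_{T*}` is `u ↦ u(0)`, with range all constants because
`Θ(0) = 0`; `𝒟_T = ker T` is `{B Θ a}` (`apply_eq_zero_iff_of_adjoint_eq_backwardShift`). For `u = B
Θ a` the Neumann series turns the characteristic function into `∑ zⁿ⁺¹ u(n) = Θ(z) a`
(`charOp_apply_coe`), so `a ↦ B Θ a` and `b ↦ b` are the inverses of the required unitaries. -/

namespace PowerPartialIsometry

noncomputable section

/-! ### Partial isometries and their defect operators -/

section Operators

variable {E F H : Type*} [NormedAddCommGroup E] [InnerProductSpace ℂ E] [CompleteSpace E]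
  [NormedAddCommGroup F] [InnerProductSpace ℂ F]
  [NormedAddCommGroup H] [InnerProductSpace ℂ H] [CompleteSpace H]

/-- Two operators out of a Hilbert space agree on a vector up to its kernel component. -/
theorem exists_mem_orthogonal_ker (T : E →L[ℂ] F) (a : E) :
    ∃ p ∈ (LinearMap.ker (T : E →ₗ[ℂ] F))ᗮ, T p = T a ∧ ‖p‖ ≤ ‖a‖ := by
  have hc : IsClosed ((LinearMap.ker (T : E →ₗ[ℂ] F) : Submodule ℂ E) : Set E) :=
    ContinuousLinearMap.isClosed_ker T
  have : CompleteSpace (LinearMap.ker (T : E →ₗ[ℂ] F)) := hc.completeSpace_coe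
  set K : Submodule ℂ E := LinearMap.ker (T : E →ₗ[ℂ] F)
  refine ⟨Kᗮ.starProjection a, Submodule.starProjection_apply_mem _ _, ?_,
    Submodule.norm_starProjection_apply_le _ _⟩
  have h := K.starProjection_add_starProjection_orthogonal a
  have h0 : T (K.starProjection a) = 0 := K.starProjection_apply_mem a
  conv_rhs => rw [← h]
  rw [map_add, h0, zero_add]

theorem IsPartialIsometry.norm_apply_le {T : E →L[ℂ] F} (hT : IsPartialIsometry T) (a : E) :
    ‖T a‖ ≤ ‖a‖ := by
  obtain ⟨p, hp, hpa, hle⟩ := exists_mem_orthogonal_ker T a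
  rw [← hpa, hT p hp]
  exact hle

/-- For `x` orthogonal to `ker T`, the vector `x - T*T x` lies both in `ker T` and in its orthogonal
complement, so `T*T x = x`. -/
theorem isPartialIsometry_of_mul_adjoint_mul {T : H →L[ℂ] H}
    (h : T * ContinuousLinearMap.adjoint T * T = T) : IsPartialIsometry T := by
  intro x hx
  have hT : ∀ y, T (ContinuousLinearMap.adjoint T (T y)) = T y := fun y =>
    congrArg (fun A : H →L[ℂ] H => A y) h
  have hk : x - ContinuousLinearMap.adjoint T (T x) ∈ LinearMap.ker (T : H →ₗ[ℂ] H) := by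
    simp [hT]
  have hr : ContinuousLinearMap.adjoint T (T x) ∈ (LinearMap.ker (T : H →ₗ[ℂ] H))ᗮ := by
    rw [Submodule.mem_orthogonal]
    intro k hk
    rw [ContinuousLinearMap.adjoint_inner_right, show T k = 0 from hk, inner_zero_left]
  have h0 := (Submodule.mem_orthogonal _ _).1 (Submodule.sub_mem _ hx hr) _ hk
  have h1 : ContinuousLinearMap.adjoint T (T x) = x := (sub_eq_zero.1 (inner_self_eq_zero.1 h0)).symm
  have h2 : ⟪T x, T x⟫_ℂ = ⟪x, x⟫_ℂ := by
    rw [← ContinuousLinearMap.adjoint_inner_left, h1]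
  rw [inner_self_eq_norm_sq_to_K, inner_self_eq_norm_sq_to_K] at h2
  have h' : ‖T x‖ ^ 2 = ‖x‖ ^ 2 := by exact_mod_cast h2
  exact (pow_left_inj₀ (norm_nonneg _) (norm_nonneg _) two_ne_zero).1 h'

/-- Here `T*T` is a projection, so `1 - T*T` is one too and is its own positive square root. -/
theorem defectOp_eq_of_mul_adjoint_mul {T : H →L[ℂ] H} (hT : ‖T‖ ≤ 1)
    (h : T * ContinuousLinearMap.adjoint T * T = T) :
    defectOp T = 1 - ContinuousLinearMap.adjoint T * T := by
  refine CFC.sqrt_unique ?_ (one_sub_adjoint_mul_self_nonneg hT)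
  have : ContinuousLinearMap.adjoint T * T * (ContinuousLinearMap.adjoint T * T) =
      ContinuousLinearMap.adjoint T * T := by
    rw [mul_assoc, ← mul_assoc T, h]
  rw [sub_mul, one_mul, mul_sub, mul_one, this, sub_self, sub_zero]

/-- The defect operator is the projection onto `ker T`, whose range is already closed. -/
theorem mem_defectSpace_iff_of_mul_adjoint_mul {T : H →L[ℂ] H} (hT : ‖T‖ ≤ 1)
    (h : T * ContinuousLinearMap.adjoint T * T = T) (x : H) :
    x ∈ defectSpace T ↔ T x = 0 := by
  have hD := defectOp_eq_of_mul_adjoint_mul hT h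
  have hr : LinearMap.range (defectOp T : H →ₗ[ℂ] H) = LinearMap.ker (T : H →ₗ[ℂ] H) := by
    ext y
    constructor
    · rintro ⟨z, rfl⟩
      have hz := congrArg (fun A : H →L[ℂ] H => A z) h
      simp only [mul_apply_eq_comp] at hz
      simp [hD, hz]
    · intro hy
      have hy' : T y = 0 := hy
      exact ⟨y, by simp [hD, hy']⟩
  have hc : IsClosed ((LinearMap.ker (T : H →ₗ[ℂ] H) : Submodule ℂ H) : Set H) :=
    ContinuousLinearMap.isClosed_ker T
  rw [defectSpace, hr, hc.submodule_topologicalClosure_eq]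
  rfl

theorem adjoint_mul_mul_adjoint_iff {T : H →L[ℂ] H} :
    ContinuousLinearMap.adjoint T * T * ContinuousLinearMap.adjoint T =
      ContinuousLinearMap.adjoint T ↔ T * ContinuousLinearMap.adjoint T * T = T := by
  simp only [← ContinuousLinearMap.star_eq_adjoint]
  constructor <;> intro h <;> simpa [mul_assoc] using congrArg star h

/-- The Neumann series of `(1 - z A)⁻¹`, evaluated at a vector. -/
theorem hasSum_inverse_one_sub_smul_apply {A : H →L[ℂ] H} (hA : ‖A‖ ≤ 1) {z : ℂ}
    (hz : ‖z‖ < 1) (x : H) :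
    HasSum (fun n : ℕ => z ^ n • (A ^ n) x) (Ring.inverse (1 - z • A) x) := by
  have hlt : ‖z • A‖ < 1 := by
    rw [norm_smul]
    exact (mul_le_of_le_one_right (norm_nonneg _) hA).trans_lt hz
  have hs := (summable_geometric_of_norm_lt_one hlt).hasSum
  rw [NormedRing.inverse_one_sub _ hlt]
  have h2 := hs.mapL (ContinuousLinearMap.apply ℂ H x)
  convert h2 using 2 with n
  · simp [smul_pow]
  · rfl

end Operators

/-! ### The backward shift -/

section Shift

variable {E : Type*} [NormedAddCommGroup E]

theorem hasSum_norm_sq (f : HardySpace E) : HasSum (fun n => ‖f n‖ ^ 2) (‖f‖ ^ 2) := by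
  have := lp.hasSum_norm (p := 2) (by norm_num) f
  simpa using this

theorem memℓp_shift (f : HardySpace E) (k : ℕ) : Memℓp (fun n => f (n + k)) 2 := by
  refine memℓp_gen ?_
  simpa using (summable_nat_add_iff k).2 (hasSum_norm_sq f).summable

variable [InnerProductSpace ℂ E]

/-- The backward shift `f ↦ (f - f(0)) / z` of the Hardy space. -/
def backwardShift : HardySpace E →L[ℂ] HardySpace E :=
  LinearMap.mkContinuous
    { toFun := fun f => ⟨fun n => f (n + 1), memℓp_shift f 1⟩
      map_add' := fun f g => by ext n; rfl
      map_smul' := fun c f => by ext n; rfl } 1 (fun f => by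
        rw [one_mul]
        refine (pow_le_pow_iff_left₀ (norm_nonneg _) (norm_nonneg _) two_ne_zero).1 ?_
        have h := (hasSum_nat_add_iff' 1).2 (hasSum_norm_sq f)
        have h' := (hasSum_norm_sq (E := E) ⟨fun n => f (n + 1), memℓp_shift f 1⟩).unique h
        simp only [Finset.range_one, Finset.sum_singleton] at h'
        exact h'.le.trans (sub_le_self _ (sq_nonneg _)))

@[simp] theorem backwardShift_apply (f : HardySpace E) (n : ℕ) :
    backwardShift f n = f (n + 1) := rfl

theorem norm_backwardShift_le : ‖(backwardShift : HardySpace E →L[ℂ] HardySpace E)‖ ≤ 1 :=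
  LinearMap.mkContinuous_norm_le _ zero_le_one _

theorem backwardShift_pow_apply (f : HardySpace E) (k n : ℕ) :
    (backwardShift ^ k) f n = f (n + k) := by
  induction k generalizing n with
  | zero => rfl
  | succ k ih =>
    rw [pow_succ', mul_apply_eq_comp, backwardShift_apply, ih]
    rw [add_assoc, add_comm 1 k]

theorem tendsto_norm_backwardShift_pow (f : HardySpace E) :
    Tendsto (fun k : ℕ => ‖(backwardShift ^ k) f‖) atTop (𝓝 0) := by
  have h : ∀ k : ℕ, ‖(backwardShift ^ k) f‖ = √(∑' n, ‖f (n + k)‖ ^ 2) := fun k => by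
    rw [← Real.sqrt_sq (norm_nonneg ((backwardShift ^ k) f)), ← (hasSum_norm_sq _).tsum_eq]
    simp only [backwardShift_pow_apply]
  simp only [h]
  have := (Real.continuous_sqrt.tendsto _).comp
    (tendsto_sum_nat_add (fun n => ‖f n‖ ^ 2))
  rw [Real.sqrt_zero] at this
  exact this

end Shift

/-! ### The Toeplitz operator of an inner function -/

section Toeplitz

variable {E F : Type*} [NormedAddCommGroup E] [InnerProductSpace ℂ E]
  [NormedAddCommGroup F] [InnerProductSpace ℂ F]

/-- Bounded convergence in `L²`. -/
theorem tendsto_L2_of_bounded {f : ℕ → L2 F} {g : L2 F} (C : ℝ)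
    (hC : ∀ k, ∀ᵐ t ∂σ, ‖f k t‖ ≤ C)
    (hlim : ∀ᵐ t ∂σ, Tendsto (fun k => f k t) atTop (𝓝 (g t))) :
    Tendsto f atTop (𝓝 g) := by
  have hg : ∀ᵐ t ∂σ, ‖g t‖ ≤ C := by
    filter_upwards [hlim, ae_all_iff.2 hC] with t h1 h2
    exact le_of_tendsto h1.norm (Eventually.of_forall h2)
  have hsub : ∀ᵐ t ∂σ, ∀ k, (f k - g : L2 F) t = f k t - g t :=
    ae_all_iff.2 fun k => Lp.coeFn_sub _ _
  -- Writing the squared `L²` norm as an integral of inner products makes scalar dominated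
  -- convergence applicable.
  have key : Tendsto (fun k => ∫ t, ⟪(f k - g : L2 F) t, (f k - g : L2 F) t⟫_ℂ ∂σ) atTop
      (𝓝 (∫ _ : 𝕋, (0 : ℂ) ∂σ)) := by
    refine tendsto_integral_of_dominated_convergence (fun _ => (C + C) * (C + C))
      (fun k => (Lp.aestronglyMeasurable _).inner (Lp.aestronglyMeasurable _))
      (integrable_const _) (fun k => ?_) ?_
    · filter_upwards [hC k, hg, hsub] with t h1 h2 h3
      rw [h3]
      have h4 : ‖f k t - g t‖ ≤ C + C := (norm_sub_le _ _).trans (add_le_add h1 h2)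
      exact (norm_inner_le_norm _ _).trans
        (mul_le_mul h4 h4 (norm_nonneg _) ((norm_nonneg _).trans h4))
    · filter_upwards [hlim, hsub] with t h1 h2
      simp only [h2]
      have h3 : Tendsto (fun k => f k t - g t) atTop (𝓝 0) := by
        simpa using h1.sub (tendsto_const_nhds (x := g t))
      simpa using h3.inner (𝕜 := ℂ) h3
  rw [integral_zero] at key
  rw [tendsto_iff_norm_sub_tendsto_zero]
  have h5 : ∀ k, ‖f k - g‖ = √ ‖∫ t, ⟪(f k - g : L2 F) t, (f k - g : L2 F) t⟫_ℂ ∂σ‖ := fun k => by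
    rw [← L2.inner_def, inner_self_eq_norm_sq_to_K]
    simp
  simp only [h5]
  have h6 := (Real.continuous_sqrt.tendsto _).comp key.norm
  rw [norm_zero, Real.sqrt_zero] at h6
  exact h6

theorem norm_laurent {Φ : 𝕋 → E →L[ℂ] F} (hΦ : IsBoundedSymbol Φ)
    (hiso : ∀ᵐ t ∂σ, ∀ a : E, ‖Φ t a‖ = ‖a‖) (h : L2 E) : ‖laurent Φ hΦ h‖ = ‖h‖ := by
  rw [Lp.norm_def, Lp.norm_def]
  congr 1
  refine eLpNorm_congr_norm_ae ?_
  filter_upwards [laurent_ae hΦ h, hiso] with t h1 h2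
  rw [h1, h2]

theorem monomial_ae (n : ℕ) (a : E) :
    (monomial n a : L2 E) =ᵐ[σ] fun t => fourier (n : ℤ) t • a :=
  (memLp_monomial n a).coeFn_toLp

/-- The monomial `t ↦ e^{int} a` as a continuous function. -/
def monomialC (n : ℕ) (a : F) : C(𝕋, F) :=
  ⟨fun t => fourier (n : ℤ) t • a, (fourier (n : ℤ)).continuous.smul continuous_const⟩

theorem toLp_monomialC (n : ℕ) (a : F) :
    ContinuousMap.toLp 2 σ ℂ (monomialC n a) = (monomial n a : L2 F) := by
  apply Lp.ext
  filter_upwards [ContinuousMap.coeFn_toLp (p := 2) (𝕜 := ℂ) σ (monomialC n a),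
    monomial_ae n a] with t h1 h2
  rw [h1, h2]
  rfl

theorem norm_monomialC_le (n : ℕ) (a : F) : ‖monomialC n a‖ ≤ ‖a‖ := by
  rw [ContinuousMap.norm_le _ (norm_nonneg _)]
  intro t
  change ‖(fourier (n : ℤ) t : ℂ) • a‖ ≤ ‖a‖
  rw [norm_smul, fourier_apply, Circle.norm_coe, one_mul]

variable [CompleteSpace F]

theorem boundary_single (n : ℕ) (a : F) : boundary (lp.single 2 n a) = monomial n a :=
  (orthogonalFamily_monomial (E := F)).linearIsometry_apply_single a

/-- An absolutely convergent series of monomials is the boundary function of an element of the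
Hardy space. -/
theorem exists_boundary_ae_of_summable (b : ℕ → F) (hb : Summable fun m => ‖b m‖) (n : ℕ) :
    ∃ g : HardySpace F,
      (boundary g =ᵐ[σ] fun t => ∑' m, fourier ((n + m : ℕ) : ℤ) t • b m) ∧
      (∀ m, g (n + m) = b m) ∧ ∀ i < n, g i = 0 := by
  have hs1 : Summable fun m => (lp.single 2 (n + m) (b m) : HardySpace F) := by
    refine Summable.of_norm ?_
    simpa [lp.norm_single] using hb
  have hs2 : Summable fun m => monomialC (n + m) (b m) :=
    Summable.of_norm_bounded hb fun m => norm_monomialC_le _ _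
  have hev : ∀ i, HasSum (fun m => (lp.single 2 (n + m) (b m) : HardySpace F) i)
      ((∑' m, lp.single 2 (n + m) (b m) : HardySpace F) i) := fun i =>
    hs1.hasSum.mapL (lp.evalCLM ℂ (fun _ : ℕ => F) 2 i)
  refine ⟨∑' m, lp.single 2 (n + m) (b m), ?_, fun m => ?_, fun i hi => ?_⟩
  -- The series is summed both in `H²` and in `C(𝕋, F)`; the images in `L²` agree, and uniform
  -- convergence supplies the pointwise values.
  · have h1 := hs1.hasSum.mapL (boundary (E := F)).toContinuousLinearMap
    have h2 := hs2.hasSum.mapL (ContinuousMap.toLp 2 σ ℂ)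
    simp only [toLp_monomialC] at h2
    simp only [LinearIsometry.coe_toContinuousLinearMap, boundary_single] at h1
    rw [h1.unique h2]
    filter_upwards [ContinuousMap.coeFn_toLp (p := 2) (𝕜 := ℂ) σ
      (∑' m, monomialC (n + m) (b m))] with t ht
    rw [ht]
    exact (ContinuousMap.hasSum_apply hs2.hasSum t).tsum_eq.symm
  · refine (hev (n + m)).unique ?_
    convert hasSum_ite_eq m (b m) using 2 with k
    by_cases hk : k = m
    · subst hk; simp
    · rw [if_neg hk, lp.single_apply_ne]
      omega
  · refine (hev i).unique ?_
    convert hasSum_zero using 2 with k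
    rw [lp.single_apply_ne]
    omega

theorem hardyProj_boundary (f : HardySpace F) : hardyProj (boundary f) = f := by
  refine ext_inner_left ℂ fun g => ?_
  rw [hardyProj, ContinuousLinearMap.adjoint_inner_right]
  exact (boundary (E := F)).inner_map_map _ _

/-- Multiplication by an inner function `Θ(z) = ∑ θₘ zᵐ⁺¹` maps monomials into the Hardy space. -/
theorem exists_boundary_eq_laurent_monomial {Θ : ℂ → E →L[ℂ] F} (hΘ : IsInner Θ)
    {θ : ℕ → E →L[ℂ] F}
    (hsum : ∀ z ∈ Metric.ball (0 : ℂ) 1, HasSum (fun m : ℕ => z ^ (m + 1) • θ m) (Θ z))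
    (hθ : ∀ m a, ‖θ m a‖ ≤ ‖a‖) (n : ℕ) (a : E) :
    ∃ g : HardySpace F,
      boundary g = laurent (boundaryValue Θ) hΘ.isBoundedSymbol (monomial n a) ∧
      (∀ m, g (n + 1 + m) = θ m a) ∧ ∀ i < n + 1, g i = 0 := by
  -- Radii tending to `1`: on each smaller circle the power series converges absolutely, and the
  -- boundary values are recovered in the limit.
  obtain ⟨u, -, hu, hlim⟩ := exists_seq_strictMono_tendsto' (show (0 : ℝ) < 1 by norm_num)
  have hb : ∀ k, Summable fun m : ℕ => ‖((u k : ℂ) ^ (m + 1)) • θ m a‖ := fun k => by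
    refine Summable.of_nonneg_of_le (fun _ => norm_nonneg _) (fun m => ?_)
      (((summable_nat_add_iff 1).2 (summable_geometric_of_lt_one (hu k).1.le (hu k).2)).mul_right
        ‖a‖)
    rw [norm_smul, norm_pow, Complex.norm_real, Real.norm_of_nonneg (hu k).1.le]
    exact mul_le_mul_of_nonneg_left (hθ m a) (pow_nonneg (hu k).1.le _)
  choose h hh1 hh2 hh3 using fun k => exists_boundary_ae_of_summable _ (hb k) (n + 1)
  have hball : ∀ k (t : 𝕋), (u k : ℂ) * fourier 1 t ∈ Metric.ball (0 : ℂ) 1 := fun k t => by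
    rw [mem_ball_zero_iff, norm_mul, fourier_apply, Circle.norm_coe, mul_one,
      Complex.norm_real, Real.norm_of_nonneg (hu k).1.le]
    exact (hu k).2
  have hval : ∀ k, boundary (h k) =ᵐ[σ]
      fun t => fourier (n : ℤ) t • Θ ((u k : ℂ) * fourier 1 t) a := fun k => by
    filter_upwards [hh1 k] with t ht
    rw [ht]
    have h1 := ((hsum _ (hball k t)).mapL (ContinuousLinearMap.apply ℂ F a)).const_smul
      (fourier (n : ℤ) t)
    refine Eq.trans ?_ h1.tsum_eq
    refine tsum_congr fun m => ?_
    have h2 : (fourier ((n + 1 + m : ℕ) : ℤ) t : ℂ) =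
        fourier (n : ℤ) t * (fourier 1 t) ^ (m + 1) := by
      have h3 : ∀ j : ℕ, (fourier ((n + j : ℕ) : ℤ) t : ℂ) =
          fourier (n : ℤ) t * (fourier 1 t) ^ j := fun j => by
        induction j with
        | zero => simp
        | succ j ih =>
          rw [show ((n + (j + 1) : ℕ) : ℤ) = ((n + j : ℕ) : ℤ) + 1 by push_cast; ring,
            fourier_add, ih, pow_succ, mul_assoc]
      rw [← h3, show n + 1 + m = n + (m + 1) by omega]
    simp only [ContinuousLinearMap.apply_apply, smul_apply, smul_smul, h2, mul_pow]
    congr 1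
    ring
  have htend : Tendsto (fun k => boundary (h k)) atTop
      (𝓝 (laurent (boundaryValue Θ) hΘ.isBoundedSymbol (monomial n a))) := by
    refine tendsto_L2_of_bounded ‖a‖ (fun k => ?_) ?_
    · filter_upwards [hval k] with t ht
      rw [ht, norm_smul, fourier_apply, Circle.norm_coe, one_mul]
      exact hΘ.contractive _ (hball k t) a
    · filter_upwards [ae_all_iff.2 hval, laurent_ae hΘ.isBoundedSymbol (monomial n a),
        monomial_ae n a, hΘ.isometry_ae] with t h1 h2 h3 h4
      simp only [h1, h2, h3, map_smul]
      refine Tendsto.const_smul ?_ _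
      exact (boundaryValue_spec h4.1 a).comp
        (tendsto_nhdsWithin_iff.2 ⟨hlim, Eventually.of_forall fun k => (hu k).2⟩)
  -- The Hardy space is closed in `L²`, so the limit belongs to it, and each coefficient is the
  -- limit of the corresponding coefficients.
  obtain ⟨g, hg⟩ := (boundary (E := F)).isometry.isClosedEmbedding.isClosed_range.mem_of_tendsto
    htend (Eventually.of_forall fun k => ⟨h k, rfl⟩)
  rw [← hg] at htend
  have hlimg : Tendsto h atTop (𝓝 g) :=
    (boundary (E := F)).isometry.isEmbedding.tendsto_nhds_iff.2 htend
  have hev : ∀ i, Tendsto (fun k => h k i) atTop (𝓝 (g i)) := fun i =>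
    ((lp.evalCLM ℂ (fun _ : ℕ => F) 2 i).continuous.tendsto g).comp hlimg
  refine ⟨g, hg, fun m => tendsto_nhds_unique (hev _) ?_, fun i hi =>
    tendsto_nhds_unique (hev i) ?_⟩
  · simp only [hh2]
    have : Tendsto (fun k => (u k : ℂ) ^ (m + 1)) atTop (𝓝 (((1 : ℝ) : ℂ) ^ (m + 1))) :=
      ((Complex.continuous_ofReal.tendsto _).comp hlim).pow _
    simpa using this.smul_const (θ m a)
  · simp only [fun k => hh3 k i hi]
    exact tendsto_const_nhds

variable [CompleteSpace E]

/-- The Toeplitz operator of an inner function with `Θ(z) = ∑ θₘ zᵐ⁺¹` is multiplication by `Θ`. -/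
theorem boundary_toeplitz {Θ : ℂ → E →L[ℂ] F} (hΘ : IsInner Θ) {θ : ℕ → E →L[ℂ] F}
    (hsum : ∀ z ∈ Metric.ball (0 : ℂ) 1, HasSum (fun m : ℕ => z ^ (m + 1) • θ m) (Θ z))
    (hθ : ∀ m a, ‖θ m a‖ ≤ ‖a‖) (f : HardySpace E) :
    boundary (toeplitz (boundaryValue Θ) hΘ.isBoundedSymbol f) =
      laurent (boundaryValue Θ) hΘ.isBoundedSymbol (boundary f) := by
  -- Once the product with `Θ` is known to stay in the Hardy space, `P₊` acts trivially. Monomials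
  -- suffice, by linearity and closedness.
  have hmem : laurent (boundaryValue Θ) hΘ.isBoundedSymbol (boundary f) ∈
      Set.range (boundary (E := F)) := by
    have h1 := (lp.hasSum_single (p := 2) (by norm_num) f).mapL
      (laurent (boundaryValue Θ) hΘ.isBoundedSymbol ∘L
        (boundary (E := E)).toContinuousLinearMap)
    have hc : IsClosed ((LinearMap.range (boundary (E := F)).toLinearMap : Submodule ℂ (L2 F)) :
        Set (L2 F)) := (boundary (E := F)).isometry.isClosedEmbedding.isClosed_range
    refine hc.mem_of_tendsto h1 (Eventually.of_forall fun s => Submodule.sum_mem _ fun i _ => ?_)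
    obtain ⟨g, hg, -⟩ := exists_boundary_eq_laurent_monomial hΘ hsum hθ i (f i)
    refine ⟨g, hg.trans ?_⟩
    rw [← boundary_single]
    rfl
  obtain ⟨g, hg⟩ := hmem
  have : toeplitz (boundaryValue Θ) hΘ.isBoundedSymbol f = g := by
    rw [← hardyProj_boundary g, hg]
    rfl
  rw [this, hg]

theorem norm_toeplitz {Θ : ℂ → E →L[ℂ] F} (hΘ : IsInner Θ) {θ : ℕ → E →L[ℂ] F}
    (hsum : ∀ z ∈ Metric.ball (0 : ℂ) 1, HasSum (fun m : ℕ => z ^ (m + 1) • θ m) (Θ z))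
    (hθ : ∀ m a, ‖θ m a‖ ≤ ‖a‖) (f : HardySpace E) :
    ‖toeplitz (boundaryValue Θ) hΘ.isBoundedSymbol f‖ = ‖f‖ := by
  rw [← (boundary (E := F)).norm_map, boundary_toeplitz hΘ hsum hθ,
    norm_laurent _ (hΘ.isometry_ae.mono fun t ht => ht.2), LinearIsometry.norm_map]

theorem toeplitz_single_apply {Θ : ℂ → E →L[ℂ] F} (hΘ : IsInner Θ) {θ : ℕ → E →L[ℂ] F}
    (hsum : ∀ z ∈ Metric.ball (0 : ℂ) 1, HasSum (fun m : ℕ => z ^ (m + 1) • θ m) (Θ z))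
    (hθ : ∀ m a, ‖θ m a‖ ≤ ‖a‖) (n : ℕ) (a : E) :
    (∀ m, toeplitz (boundaryValue Θ) hΘ.isBoundedSymbol (lp.single 2 n a) (n + 1 + m) = θ m a) ∧
      ∀ i < n + 1, toeplitz (boundaryValue Θ) hΘ.isBoundedSymbol (lp.single 2 n a) i = 0 := by
  obtain ⟨g, hg, h1, h2⟩ := exists_boundary_eq_laurent_monomial hΘ hsum hθ n a
  have : toeplitz (boundaryValue Θ) hΘ.isBoundedSymbol (lp.single 2 n a) = g := by
    refine (boundary (E := F)).injective ?_
    rw [boundary_toeplitz hΘ hsum hθ, boundary_single, hg]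
  rw [this]
  exact ⟨h1, h2⟩

end Toeplitz

/-! ### Isometric multiplication operators with partially isometric coefficients -/

section Multiplication

variable {E F : Type*} [NormedAddCommGroup E] [InnerProductSpace ℂ E]
  [NormedAddCommGroup F] [InnerProductSpace ℂ F]

theorem hasSum_inner_nat_add (k : ℕ) {f g : HardySpace F} (h : ∀ i < k, ⟪f i, g i⟫_ℂ = 0) :
    HasSum (fun m => ⟪f (m + k), g (m + k)⟫_ℂ) ⟪f, g⟫_ℂ := by
  have h1 := (hasSum_nat_add_iff' (f := fun i => ⟪f i, g i⟫_ℂ) k).2 (lp.hasSum_inner f g)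
  rwa [Finset.sum_eq_zero fun i hi => h i (Finset.mem_range.1 hi), sub_zero] at h1

/-- `M` is an isometric operator of multiplication by a power series `∑ θₘ zᵐ⁺¹`. -/
structure IsIsometricMultiplication (M : HardySpace E →L[ℂ] HardySpace F)
    (θ : ℕ → E →L[ℂ] F) : Prop where
  norm_map : ∀ f, ‖M f‖ = ‖f‖
  single_apply_add : ∀ n a m, M (lp.single 2 n a) (n + 1 + m) = θ m a
  single_apply_of_lt : ∀ n a, ∀ i < n + 1, M (lp.single 2 n a) i = 0

namespace IsIsometricMultiplication

variable {M : HardySpace E →L[ℂ] HardySpace F} {θ : ℕ → E →L[ℂ] F}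

theorem inner_map_map (hM : IsIsometricMultiplication M θ) (f g : HardySpace E) :
    ⟪M f, M g⟫_ℂ = ⟪f, g⟫_ℂ :=
  (⟨M.toLinearMap, hM.norm_map⟩ : HardySpace E →ₗᵢ[ℂ] HardySpace F).inner_map_map f g

theorem hasSum_inner (hM : IsIsometricMultiplication M θ) (n : ℕ) (a : E) (u : HardySpace F) :
    HasSum (fun m => ⟪θ m a, u (n + 1 + m)⟫_ℂ) ⟪M (lp.single 2 n a), u⟫_ℂ := by
  have h := hasSum_inner_nat_add (n + 1) (f := M (lp.single 2 n a)) (g := u) fun i hi => by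
    rw [hM.single_apply_of_lt n a i hi, inner_zero_left]
  refine h.congr_fun fun m => ?_
  rw [← hM.single_apply_add n a m, add_comm m]

/-- Parseval for `M` applied to the constant `a`; the coefficient of index `0` vanishes. -/
theorem hasSum_norm_sq_apply (hM : IsIsometricMultiplication M θ) (a : E) :
    HasSum (fun m => ‖θ m a‖ ^ 2) (‖a‖ ^ 2) := by
  have h := (hasSum_nat_add_iff' 1).2 (hasSum_norm_sq (M (lp.single 2 0 a)))
  rw [hM.norm_map, lp.norm_single (by norm_num), Finset.sum_range_one,
    hM.single_apply_of_lt 0 a 0 zero_lt_one, norm_zero] at h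
  rw [zero_pow two_ne_zero, sub_zero] at h
  refine h.congr_fun fun m => ?_
  rw [← hM.single_apply_add 0 a m, zero_add, add_comm]

/-- The term `‖θⱼ a‖² = ‖a‖²` already fills the whole sum `∑ ‖θₘ a‖² = ‖a‖²`, leaving nothing for
the others. -/
theorem apply_eq_zero (hM : IsIsometricMultiplication M θ) {i j : ℕ} (hij : i ≠ j)
    (hθ : IsPartialIsometry (θ j)) {a : E}
    (ha : a ∈ (LinearMap.ker (θ j : E →ₗ[ℂ] F))ᗮ) : θ i a = 0 := by
  have h := sum_le_hasSum {i, j} (fun _ _ => sq_nonneg _) (hM.hasSum_norm_sq_apply a)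
  rw [Finset.sum_pair hij, hθ a ha] at h
  have : ‖θ i a‖ ^ 2 ≤ 0 := by linarith
  exact norm_eq_zero.1 (pow_eq_zero_iff two_ne_zero |>.1 (le_antisymm this (sq_nonneg _)))

/-- Multiplication by `Θ` commutes with multiplication by `z`, whose adjoint is the backward shift.
-/
theorem inner_single_succ (hM : IsIsometricMultiplication M θ) (n : ℕ) (a : E)
    (u : HardySpace F) :
    ⟪M (lp.single 2 (n + 1) a), u⟫_ℂ = ⟪M (lp.single 2 n a), backwardShift u⟫_ℂ := by
  refine (hM.hasSum_inner (n + 1) a u).unique ?_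
  refine (hM.hasSum_inner n a (backwardShift u)).congr_fun fun m => ?_
  rw [backwardShift_apply, show n + 1 + m + 1 = n + 1 + 1 + m by omega]

variable [CompleteSpace E] [CompleteSpace F]

theorem adjoint_apply_map (hM : IsIsometricMultiplication M θ) (f : HardySpace E) :
    ContinuousLinearMap.adjoint M (M f) = f := by
  refine ext_inner_left ℂ fun g => ?_
  rw [ContinuousLinearMap.adjoint_inner_right, hM.inner_map_map]

/-- From `M*M = 1`, the operator `1 - M M*` is the projection onto `ker M*`. -/
theorem mem_range_one_sub_iff (hM : IsIsometricMultiplication M θ) (u : HardySpace F) :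
    u ∈ LinearMap.range ((1 - M ∘L ContinuousLinearMap.adjoint M :
      HardySpace F →L[ℂ] HardySpace F) : HardySpace F →ₗ[ℂ] HardySpace F) ↔
      ContinuousLinearMap.adjoint M u = 0 := by
  constructor
  · rintro ⟨v, rfl⟩
    simp [hM.adjoint_apply_map]
  · intro h
    exact ⟨u, by simp [h]⟩

end IsIsometricMultiplication

theorem adjoint_eq_zero_iff_forall_single [CompleteSpace E] [CompleteSpace F]
    {M : HardySpace E →L[ℂ] HardySpace F} (u : HardySpace F) :
    ContinuousLinearMap.adjoint M u = 0 ↔ ∀ n a, ⟪M (lp.single 2 n a), u⟫_ℂ = 0 := by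
  simp only [← ContinuousLinearMap.adjoint_inner_right, lp.inner_single_left]
  constructor
  · intro h n a
    simp [h]
  · intro h
    ext n
    exact inner_self_eq_zero.1 (h n _)

theorem IsIsometricMultiplication.adjoint_eq_zero_iff [CompleteSpace E] [CompleteSpace F]
    {M : HardySpace E →L[ℂ] HardySpace F} {θ : ℕ → E →L[ℂ] F}
    (hM : IsIsometricMultiplication M θ) (hθ : ∀ j, IsPartialIsometry (θ j)) (u : HardySpace F) :
    ContinuousLinearMap.adjoint M u = 0 ↔ ∀ n j a, ⟪θ j a, u (n + 1 + j)⟫_ℂ = 0 := by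
  rw [adjoint_eq_zero_iff_forall_single]
  constructor
  · intro h n j a
    -- Replacing `a` by its component orthogonal to `ker θⱼ` keeps `θⱼ a` and makes all other
    -- coefficients vanish, so the series for the inner product has one term.
    obtain ⟨p, hp, hpa, -⟩ := exists_mem_orthogonal_ker (θ j) a
    rw [← hpa, ← h n p]
    refine (hasSum_single j fun i hi => ?_).unique (hM.hasSum_inner n p u)
    rw [hM.apply_eq_zero hi (hθ j) hp, inner_zero_left]
  · intro h n a
    refine (hM.hasSum_inner n a u).unique ?_
    simp only [h]
    exact hasSum_zero

end Multiplication

/-! ### Truncation of power series -/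

section Truncation

variable {E : Type*} [NormedAddCommGroup E]

/-- Drop the coefficients of index less than `n`. -/
def dropLow (n : ℕ) (f : HardySpace E) : HardySpace E :=
  ⟨fun i => if i < n then 0 else f i, memℓp_gen (by
    refine Summable.of_nonneg_of_le (fun i => by positivity) (fun i => ?_)
      (hasSum_norm_sq f).summable
    split_ifs
    · simp
    · simp)⟩

theorem dropLow_apply (n : ℕ) (f : HardySpace E) (i : ℕ) :
    dropLow n f i = if i < n then 0 else f i := rfl

theorem dropLow_one (f : HardySpace E) : dropLow 1 f = f - lp.single 2 0 (f 0) := by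
  ext i
  rw [dropLow_apply, lp.coeFn_sub, Pi.sub_apply]
  rcases Nat.eq_zero_or_pos i with rfl | hi
  · simp
  · rw [if_neg (by omega), lp.single_apply_ne _ _ _ (by omega), sub_zero]

variable [InnerProductSpace ℂ E]

theorem backwardShift_pow_dropLow (n : ℕ) (f : HardySpace E) :
    (backwardShift ^ n) (dropLow n f) = (backwardShift ^ n) f := by
  ext i
  rw [backwardShift_pow_apply, backwardShift_pow_apply, dropLow_apply, if_neg (by omega)]

/-- The weak form of `B*ⁿ Bⁿ = dropLow n`. -/
theorem inner_backwardShift_pow (n : ℕ) (f g : HardySpace E) :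
    ⟪(backwardShift ^ n) f, (backwardShift ^ n) g⟫_ℂ = ⟪f, dropLow n g⟫_ℂ := by
  have h := hasSum_inner_nat_add n (f := f) (g := dropLow n g) fun i hi => by
    rw [dropLow_apply, if_pos hi, inner_zero_right]
  refine (lp.hasSum_inner _ _).unique (h.congr_fun fun i => ?_)
  rw [backwardShift_pow_apply, backwardShift_pow_apply, dropLow_apply, if_neg (by omega)]

theorem adjoint_backwardShift_single [CompleteSpace E] (n : ℕ) (a : E) :
    ContinuousLinearMap.adjoint backwardShift (lp.single 2 n a : HardySpace E) =
      lp.single 2 (n + 1) a := by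
  refine ext_inner_right ℂ fun g => ?_
  rw [ContinuousLinearMap.adjoint_inner_left, lp.inner_single_left, lp.inner_single_left]
  rfl

theorem backwardShift_adjoint_backwardShift [CompleteSpace E] (f : HardySpace E) :
    backwardShift (ContinuousLinearMap.adjoint backwardShift f) = f := by
  ext n
  refine ext_inner_left ℂ fun a => ?_
  refine (lp.inner_single_left (n + 1) a (ContinuousLinearMap.adjoint backwardShift f)).symm.trans
    (Eq.trans ?_ (lp.inner_single_left (𝕜 := ℂ) n a f))
  rw [ContinuousLinearMap.adjoint_inner_right]
  congr 1
  ext i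
  rw [backwardShift_apply, lp.single_apply, lp.single_apply]
  by_cases h : i = n <;> simp [h]

end Truncation

/-! ### The model operator -/

section Model

variable {E F : Type*} [NormedAddCommGroup E] [InnerProductSpace ℂ E]
  [NormedAddCommGroup F] [InnerProductSpace ℂ F]

section Membership

variable {M : HardySpace E →L[ℂ] HardySpace F} {θ : ℕ → E →L[ℂ] F}

theorem IsIsometricMultiplication.backwardShift_map_single_apply
    (hM : IsIsometricMultiplication M θ) (a : E) (n : ℕ) :
    backwardShift (M (lp.single 2 0 a)) n = θ n a := by
  rw [backwardShift_apply, ← hM.single_apply_add 0 a n, zero_add, add_comm]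

theorem IsIsometricMultiplication.norm_backwardShift_map_single
    (hM : IsIsometricMultiplication M θ) (a : E) :
    ‖backwardShift (M (lp.single 2 0 a))‖ = ‖a‖ := by
  have h := (hasSum_norm_sq (backwardShift (M (lp.single 2 0 a)))).unique
    ((hM.hasSum_norm_sq_apply a).congr_fun fun n => by
      rw [hM.backwardShift_map_single_apply])
  exact (pow_left_inj₀ (norm_nonneg _) (norm_nonneg _) two_ne_zero).1 h

/-- The map `a ↦ (Θ(z) a) / z` into the Hardy space. -/
def IsIsometricMultiplication.coefficientIsometry (hM : IsIsometricMultiplication M θ) :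
    E →ₗᵢ[ℂ] HardySpace F where
  toFun a := backwardShift (M (lp.single 2 0 a))
  map_add' a b := by rw [lp.single_add, map_add, map_add]
  map_smul' c a := by rw [lp.single_smul, map_smul, map_smul, RingHom.id_apply]
  norm_map' := hM.norm_backwardShift_map_single

variable [CompleteSpace E] [CompleteSpace F]

theorem IsIsometricMultiplication.adjoint_backwardShift_eq_zero
    (hM : IsIsometricMultiplication M θ) {u : HardySpace F}
    (hu : ContinuousLinearMap.adjoint M u = 0) :
    ContinuousLinearMap.adjoint M (backwardShift u) = 0 := by
  rw [adjoint_eq_zero_iff_forall_single] at hu ⊢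
  intro n a
  rw [← hM.inner_single_succ, hu]

/-- Membership is tested on each coefficient separately, and zero passes every test. This is where
the partial isometry hypothesis is decisive. -/
theorem IsIsometricMultiplication.adjoint_dropLow_eq_zero
    (hM : IsIsometricMultiplication M θ) (hθ : ∀ j, IsPartialIsometry (θ j)) (k : ℕ)
    {u : HardySpace F} (hu : ContinuousLinearMap.adjoint M u = 0) :
    ContinuousLinearMap.adjoint M (dropLow k u) = 0 := by
  rw [hM.adjoint_eq_zero_iff hθ] at hu ⊢
  intro n j a
  rw [dropLow_apply]
  split_ifs
  · exact inner_zero_right _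
  · exact hu n j a

theorem IsIsometricMultiplication.adjoint_single_zero
    (hM : IsIsometricMultiplication M θ) (b : F) :
    ContinuousLinearMap.adjoint M (lp.single 2 0 b) = 0 := by
  rw [adjoint_eq_zero_iff_forall_single]
  intro n a
  rw [lp.inner_single_right, hM.single_apply_of_lt n a 0 (Nat.succ_pos n), inner_zero_left]

/-- Moving the shift across gives `⟪M zⁿ⁺¹ b, M a⟫ = ⟪zⁿ⁺¹ b, a⟫ = 0`. -/
theorem IsIsometricMultiplication.adjoint_backwardShift_map_single
    (hM : IsIsometricMultiplication M θ) (a : E) :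
    ContinuousLinearMap.adjoint M (backwardShift (M (lp.single 2 0 a))) = 0 := by
  rw [adjoint_eq_zero_iff_forall_single]
  intro n b
  rw [← hM.inner_single_succ, hM.inner_map_map, lp.inner_single_left,
    lp.single_apply_ne _ _ _ (Nat.succ_ne_zero n), inner_zero_right]

end Membership

/-- The inclusion of the constant functions into the Hardy space. -/
def constantIsometry : F →ₗᵢ[ℂ] HardySpace F where
  toFun b := lp.single 2 0 b
  map_add' a b := by rw [lp.single_add]
  map_smul' c b := by rw [lp.single_smul, RingHom.id_apply]
  norm_map' := lp.norm_single (E := fun _ : ℕ => F) (p := 2) (by norm_num) 0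

theorem coincide_of_apply_eq {E E' F F' : Type*} [NormedAddCommGroup E] [InnerProductSpace ℂ E]
    [NormedAddCommGroup F] [InnerProductSpace ℂ F] [NormedAddCommGroup E']
    [InnerProductSpace ℂ E'] [NormedAddCommGroup F'] [InnerProductSpace ℂ F']
    {Ψ : ℂ → E →L[ℂ] F} {Θ : ℂ → E' →L[ℂ] F'} (V : E' ≃ₗᵢ[ℂ] E) (W : F' ≃ₗᵢ[ℂ] F)
    (h : ∀ z ∈ Metric.ball (0 : ℂ) 1, ∀ a, Ψ z (V a) = W (Θ z a)) : Coincide Ψ Θ := by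
  refine ⟨V.symm, W.symm, fun z hz u => ?_⟩
  obtain ⟨a, rfl⟩ := V.surjective u
  rw [V.symm_apply_apply, W.symm_apply_eq]
  exact h z hz a

theorem exists_linearIsometryEquiv_of_mem_iff {G H : Type*} [NormedAddCommGroup G]
    [InnerProductSpace ℂ G] [NormedAddCommGroup H] [InnerProductSpace ℂ H]
    (J : G →ₗᵢ[ℂ] H) {K : Submodule ℂ H} {D : Submodule ℂ K} (hK : ∀ a, J a ∈ K)
    (hD : ∀ u : K, u ∈ D ↔ ∃ a, (u : H) = J a) :
    ∃ V : G ≃ₗᵢ[ℂ] D, ∀ a, ((V a : K) : H) = J a := by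
  let V : G →ₗᵢ[ℂ] D :=
    { toFun := fun a => ⟨⟨J a, hK a⟩, (hD _).2 ⟨a, rfl⟩⟩
      map_add' := fun a b => Subtype.ext (Subtype.ext (map_add J a b))
      map_smul' := fun c a => Subtype.ext (Subtype.ext (map_smul J c a))
      norm_map' := fun a => J.norm_map a }
  have hV : Function.Surjective V := fun u => by
    obtain ⟨a, ha⟩ := (hD u).1 u.2
    exact ⟨a, Subtype.ext (Subtype.ext ha.symm)⟩
  exact ⟨LinearIsometryEquiv.ofSurjective V hV, fun a => rfl⟩

/-- The restriction of the backward shift to an invariant subspace. -/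
def restrictedShift (K : Submodule ℂ (HardySpace F)) (hK : ∀ u ∈ K, backwardShift u ∈ K) :
    K →L[ℂ] K :=
  (backwardShift.comp K.subtypeL).codRestrict K fun u => hK u u.2

/-! ### Contractions whose adjoint is the backward shift on a subspace. -/

variable {K : Submodule ℂ (HardySpace F)} [CompleteSpace K] {T : K →L[ℂ] K}
  (hT : ∀ u : K, (ContinuousLinearMap.adjoint T u : HardySpace F) = backwardShift u)

include hT

theorem adjoint_pow_apply_coe (n : ℕ) (u : K) :
    (((ContinuousLinearMap.adjoint T) ^ n) u : HardySpace F) = (backwardShift ^ n) u := by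
  induction n with
  | zero => rfl
  | succ n ih => rw [pow_succ', mul_apply_eq_comp, hT, ih, pow_succ', mul_apply_eq_comp]

theorem norm_le_one_of_adjoint_eq_backwardShift : ‖T‖ ≤ 1 := by
  rw [← LinearIsometryEquiv.norm_map ContinuousLinearMap.adjoint]
  refine ContinuousLinearMap.opNorm_le_bound _ zero_le_one fun u => ?_
  rw [Submodule.coe_norm, hT]
  exact ContinuousLinearMap.le_of_opNorm_le _ norm_backwardShift_le _

theorem isPure_of_adjoint_eq_backwardShift : IsPure T := by
  refine ⟨norm_le_one_of_adjoint_eq_backwardShift hT, fun u => ?_⟩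
  have h := tendsto_norm_backwardShift_pow (u : HardySpace F)
  simp only [← adjoint_pow_apply_coe hT] at h
  exact h

variable (hdrop : ∀ n, ∀ u ∈ K, dropLow n u ∈ K)

include hdrop

/-- Pairing with `v` in `K` gives `⟪Bⁿ v, Bⁿ u⟫ = ⟪v, dropLow n u⟫`; since the truncation stays in
`K`, no further projection is needed. -/
theorem pow_adjoint_pow_apply_coe (n : ℕ) (u : K) :
    ((T ^ n) (((ContinuousLinearMap.adjoint T) ^ n) u) : HardySpace F) = dropLow n u := by
  have h : (T ^ n) (((ContinuousLinearMap.adjoint T) ^ n) u) = ⟨dropLow n u, hdrop n u u.2⟩ := by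
    refine ext_inner_left ℂ fun v => ?_
    have hp : (ContinuousLinearMap.adjoint T) ^ n = ContinuousLinearMap.adjoint (T ^ n) := by
      simp only [← ContinuousLinearMap.star_eq_adjoint, star_pow]
    rw [← ContinuousLinearMap.adjoint_inner_left, ← hp, Submodule.coe_inner,
      adjoint_pow_apply_coe hT, adjoint_pow_apply_coe hT, inner_backwardShift_pow]
    rfl
  rw [h]

/-- In adjoint form: `Bⁿ` does not see the coefficients that `Tⁿ T*ⁿ` deletes. -/
theorem pow_mul_adjoint_mul_pow (n : ℕ) :
    T ^ n * ContinuousLinearMap.adjoint (T ^ n) * T ^ n = T ^ n := by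
  have hp : ContinuousLinearMap.adjoint (T ^ n) = (ContinuousLinearMap.adjoint T) ^ n := by
    simp only [← ContinuousLinearMap.star_eq_adjoint, star_pow]
  rw [← adjoint_mul_mul_adjoint_iff, hp]
  ext1 u
  refine Subtype.ext ?_
  simp only [mul_apply_eq_comp]
  rw [adjoint_pow_apply_coe hT, pow_adjoint_pow_apply_coe hT hdrop, backwardShift_pow_dropLow,
    adjoint_pow_apply_coe hT]

theorem isPowerPartialIsometry_of_adjoint_eq_backwardShift : IsPowerPartialIsometry T :=
  fun n _ => isPartialIsometry_of_mul_adjoint_mul (pow_mul_adjoint_mul_pow hT hdrop n)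

theorem mul_adjoint_mul_self : T * ContinuousLinearMap.adjoint T * T = T := by
  simpa using pow_mul_adjoint_mul_pow hT hdrop 1

theorem defectOp_adjoint_apply_coe (u : K) :
    (defectOp (ContinuousLinearMap.adjoint T) u : HardySpace F) =
      lp.single 2 0 ((u : HardySpace F) 0) := by
  have hT1 := norm_le_one_of_adjoint_eq_backwardShift hT
  have h1 : ‖ContinuousLinearMap.adjoint T‖ ≤ 1 := by
    rwa [LinearIsometryEquiv.norm_map]
  have h2 := (adjoint_mul_mul_adjoint_iff (T := T)).2 (mul_adjoint_mul_self hT hdrop)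
  rw [defectOp_eq_of_mul_adjoint_mul h1 (by rwa [ContinuousLinearMap.adjoint_adjoint]),
    ContinuousLinearMap.adjoint_adjoint]
  have h3 := pow_adjoint_pow_apply_coe hT hdrop 1 u
  rw [pow_one, pow_one, dropLow_one] at h3
  simp [h3]

theorem mem_defectSpace_adjoint_iff (u : K) :
    u ∈ defectSpace (ContinuousLinearMap.adjoint T) ↔
      ∃ b, (u : HardySpace F) = lp.single 2 0 b := by
  have hT1 := norm_le_one_of_adjoint_eq_backwardShift hT
  have h1 : ‖ContinuousLinearMap.adjoint T‖ ≤ 1 := by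
    rwa [LinearIsometryEquiv.norm_map]
  have h2 := (adjoint_mul_mul_adjoint_iff (T := T)).2 (mul_adjoint_mul_self hT hdrop)
  rw [mem_defectSpace_iff_of_mul_adjoint_mul h1 (by rwa [ContinuousLinearMap.adjoint_adjoint]),
    ← Submodule.coe_eq_zero, hT]
  constructor
  · intro h
    refine ⟨(u : HardySpace F) 0, ?_⟩
    ext i
    rcases i with _ | i
    · simp
    · rw [← backwardShift_apply, h, lp.single_apply_ne _ _ _ (Nat.succ_ne_zero i)]
      rfl
  · rintro ⟨b, hb⟩
    ext i
    rw [hb, backwardShift_apply, lp.single_apply_ne _ _ _ (Nat.succ_ne_zero i)]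
    rfl

theorem charOp_apply_coe {u : K} (hu : T u = 0) {z : ℂ} (hz : ‖z‖ < 1) {b : F}
    (hb : HasSum (fun n => z ^ (n + 1) • (u : HardySpace F) n) b) :
    (charOp T z u : HardySpace F) = lp.single 2 0 b := by
  have hT1 := norm_le_one_of_adjoint_eq_backwardShift hT
  have hA : ‖ContinuousLinearMap.adjoint T‖ ≤ 1 := by
    rwa [LinearIsometryEquiv.norm_map]
  have hD : defectOp T u = u := by
    rw [defectOp_eq_of_mul_adjoint_mul hT1 (mul_adjoint_mul_self hT hdrop)]
    simp [hu]
  have h1 := ((hasSum_inverse_one_sub_smul_apply hA hz u).mapL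
    ((lp.evalCLM ℂ (fun _ : ℕ => F) 2 0).comp K.subtypeL)).const_smul z
  -- The Neumann series evaluated at coefficient `0`: `(Bⁿ u)(0) = u(n)`, and the outer factor `z`
  -- raises the exponent to `n + 1`.
  have h2 : z • ((Ring.inverse (1 - z • ContinuousLinearMap.adjoint T) u : K) :
      HardySpace F) 0 = b := by
    refine h1.unique (hb.congr_fun fun n => ?_)
    change z • (z ^ n • ((((ContinuousLinearMap.adjoint T) ^ n) u : K) : HardySpace F) 0) =
      z ^ (n + 1) • (u : HardySpace F) n
    rw [adjoint_pow_apply_coe hT, backwardShift_pow_apply, zero_add, smul_smul, pow_succ']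
  have h3 : charOp T z u = z • defectOp (ContinuousLinearMap.adjoint T)
      (Ring.inverse (1 - z • ContinuousLinearMap.adjoint T) u) := by
    simp [charOp, hu, hD]
  rw [h3, Submodule.coe_smul, defectOp_adjoint_apply_coe hT hdrop, ← lp.single_smul, h2]

variable [CompleteSpace E] [CompleteSpace F]

omit hdrop in
-- With `S = B*` the forward shift, `T u = 0` says that `S u` is orthogonal to `K = ker M*`, hence
-- lies in the range of the isometry `M`; applying `B` recovers `u`.
theorem apply_eq_zero_iff_of_adjoint_eq_backwardShift
    {M : HardySpace E →L[ℂ] HardySpace F} {θ : ℕ → E →L[ℂ] F}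
    (hM : IsIsometricMultiplication M θ)
    (hK : ∀ u, u ∈ K ↔ ContinuousLinearMap.adjoint M u = 0) (u : K) :
    T u = 0 ↔ ∃ a, (u : HardySpace F) = backwardShift (M (lp.single 2 0 a)) := by
  have hin : ∀ v : K, ⟪T u, v⟫_ℂ = ⟪(u : HardySpace F), backwardShift v⟫_ℂ := fun v => by
    rw [← ContinuousLinearMap.adjoint_inner_right, Submodule.coe_inner, hT]
  constructor
  · intro hu
    set f := ContinuousLinearMap.adjoint backwardShift (u : HardySpace F) with hf
    have hfK : ∀ v : K, ⟪f, v⟫_ℂ = 0 := fun v => by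
      rw [hf, ContinuousLinearMap.adjoint_inner_left, ← hin, hu, inner_zero_left]
    set g := ContinuousLinearMap.adjoint M f with hg
    have hfg : f = M g := by
      have hmem : f - M g ∈ K := by
        rw [hK, map_sub, hM.adjoint_apply_map, ← hg, sub_self]
      have h1 : ⟪f - M g, f - M g⟫_ℂ = 0 := by
        conv_lhs => rw [inner_sub_left]
        rw [hfK ⟨_, hmem⟩, ← ContinuousLinearMap.adjoint_inner_right, (hK _).1 hmem,
          inner_zero_right, sub_zero]
      exact sub_eq_zero.1 (inner_self_eq_zero.1 h1)
    -- A higher coefficient of `g` pairs with `b` as `⟪M zⁱ⁺¹ b, S u⟫ = ⟪M zⁱ b, B S u⟫ = ⟪M zⁱ b,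
    -- u⟫`, which is `0` because `u` is in `K`.
    have hg0 : g = lp.single 2 0 (g 0) := by
      ext i
      rcases i with _ | i
      · simp
      · rw [lp.single_apply_ne _ _ _ (Nat.succ_ne_zero i)]
        refine ext_inner_left ℂ fun b => ?_
        refine (lp.inner_single_left (𝕜 := ℂ) (i + 1) b g).symm.trans ?_
        rw [inner_zero_right, hg, ContinuousLinearMap.adjoint_inner_right, hM.inner_single_succ,
          hf, backwardShift_adjoint_backwardShift, ← ContinuousLinearMap.adjoint_inner_right,
          (hK _).1 u.2, inner_zero_right]
    refine ⟨g 0, ?_⟩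
    rw [← hg0, ← hfg, hf, backwardShift_adjoint_backwardShift]
  · rintro ⟨a, ha⟩
    refine ext_inner_right ℂ fun v => ?_
    rw [hin, ha, inner_zero_left]
    have h0 := (adjoint_eq_zero_iff_forall_single _).1 ((hK _).1 v.2) 0 a
    rw [← h0]
    have h1 := inner_backwardShift_pow 1 (M (lp.single 2 0 a)) (v : HardySpace F)
    rw [pow_one] at h1
    rw [h1, dropLow_one, inner_sub_right, lp.inner_single_right,
      hM.single_apply_of_lt 0 a 0 zero_lt_one, inner_zero_left, sub_zero]

/-- The characteristic function of the model operator. -/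
theorem coincide_charFun {M : HardySpace E →L[ℂ] HardySpace F} {θ : ℕ → E →L[ℂ] F}
    (hM : IsIsometricMultiplication M θ)
    (hK : ∀ u, u ∈ K ↔ ContinuousLinearMap.adjoint M u = 0) {Θ : ℂ → E →L[ℂ] F}
    (hsum : ∀ z ∈ Metric.ball (0 : ℂ) 1, HasSum (fun m : ℕ => z ^ (m + 1) • θ m) (Θ z))
    (hT1 : ‖T‖ ≤ 1) :
    Coincide (E := defectSpace T) (F := defectSpace (ContinuousLinearMap.adjoint T))
      (charFun T hT1) Θ := by
  have hTT := mul_adjoint_mul_self hT hdrop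
  have hkerT : ∀ u : K, u ∈ defectSpace T ↔
      ∃ a, (u : HardySpace F) = backwardShift (M (lp.single 2 0 a)) := fun u =>
    (mem_defectSpace_iff_of_mul_adjoint_mul hT1 hTT u).trans
      (apply_eq_zero_iff_of_adjoint_eq_backwardShift hT hM hK u)
  obtain ⟨V, hV⟩ := exists_linearIsometryEquiv_of_mem_iff hM.coefficientIsometry
    (fun a => (hK _).2 (hM.adjoint_backwardShift_map_single a)) hkerT
  obtain ⟨W, hW⟩ := exists_linearIsometryEquiv_of_mem_iff (constantIsometry (F := F))
    (fun b => (hK _).2 (hM.adjoint_single_zero b)) (mem_defectSpace_adjoint_iff hT hdrop)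
  refine coincide_of_apply_eq V W fun z hz a => Subtype.ext (Subtype.ext ?_)
  rw [hW]
  refine charOp_apply_coe hT hdrop ((mem_defectSpace_iff_of_mul_adjoint_mul hT1 hTT _).1 (V a).2)
    (mem_ball_zero_iff.1 hz) ?_
  refine ((hsum z hz).mapL (ContinuousLinearMap.apply ℂ F a)).congr_fun fun n => ?_
  rw [hV]
  exact congrArg (z ^ (n + 1) • ·) (hM.backwardShift_map_single_apply a n)

end Model

/-! ### Boundary values of the backward shift -/

theorem boundary_backwardShift_ae {F : Type*} [NormedAddCommGroup F] [InnerProductSpace ℂ F]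
    [CompleteSpace F] (f : HardySpace F) :
    ∀ᵐ t ∂σ, boundary (backwardShift f) t = fourier (-1) t • (boundary f t - f 0) := by
  have hΦ : IsBoundedSymbol fun t : 𝕋 => (fourier 1 t : ℂ) • ContinuousLinearMap.id ℂ F :=
    { measurable := fun a => ((fourier 1).continuous.smul continuous_const).aestronglyMeasurable
      bounded := ⟨1, Eventually.of_forall fun t => by
        rw [norm_smul, fourier_apply, Circle.norm_coe, one_mul]
        exact ContinuousLinearMap.norm_id_le⟩ }
  have hmono : ∀ n (a : F), laurent _ hΦ (monomial n a) = monomial (n + 1) a := fun n a => by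
    apply Lp.ext
    filter_upwards [laurent_ae hΦ (monomial n a), monomial_ae n a, monomial_ae (n + 1) a]
      with t h1 h2 h3
    rw [h1, h2, h3, smul_apply, ContinuousLinearMap.id_apply, smul_smul, Nat.cast_succ,
      fourier_add, mul_comm]
  -- Multiplication by `e^{it}` realizes `B*` on boundary functions. Applied to `B f`, with `B* B f
  -- = f - f(0)`, it yields the formula after division by `e^{it}`.
  have hmul : ∀ g : HardySpace F, laurent _ hΦ (boundary g) =
      boundary (ContinuousLinearMap.adjoint backwardShift g) := fun g => by
    have hs := lp.hasSum_single (p := 2) (by norm_num) g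
    have h1 := hs.mapL (laurent _ hΦ ∘L (boundary (E := F)).toContinuousLinearMap)
    have h2 := hs.mapL ((boundary (E := F)).toContinuousLinearMap ∘L
      ContinuousLinearMap.adjoint backwardShift)
    refine h1.unique (h2.congr_fun fun n => ?_)
    change laurent _ hΦ (boundary (lp.single 2 n (g n))) =
      boundary (ContinuousLinearMap.adjoint backwardShift (lp.single 2 n (g n)))
    rw [adjoint_backwardShift_single, boundary_single, boundary_single, hmono]
  have hdec : ContinuousLinearMap.adjoint backwardShift (backwardShift f) =
      f - lp.single 2 0 (f 0) := by
    refine ext_inner_left ℂ fun g => ?_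
    rw [ContinuousLinearMap.adjoint_inner_right, ← dropLow_one]
    exact inner_backwardShift_pow 1 g f
  have hfin := hmul (backwardShift f)
  rw [hdec, map_sub, boundary_single] at hfin
  filter_upwards [laurent_ae hΦ (boundary (backwardShift f)), monomial_ae 0 (f 0),
    Lp.coeFn_sub (boundary f) (monomial 0 (f 0))] with t h1 h2 h3
  rw [hfin, h3, Pi.sub_apply, h2] at h1
  simp only [Nat.cast_zero, fourier_zero, one_smul] at h1
  rw [h1, smul_apply, ContinuousLinearMap.id_apply, smul_smul, ← fourier_add]
  simp

end

end PowerPartialIsometry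

/-! ### The model theorem. -/

theorem mainTheorem7 {E F : Type*}
    [NormedAddCommGroup E] [InnerProductSpace ℂ E] [CompleteSpace E]
    [TopologicalSpace.SeparableSpace E]
    [NormedAddCommGroup F] [InnerProductSpace ℂ F] [CompleteSpace F]
    [TopologicalSpace.SeparableSpace F]
    (Θ : ℂ → E →L[ℂ] F) (θ : ℕ → E →L[ℂ] F)
    (hpure : PowerPartialIsometry.IsPurelyContractive Θ)
    (hinner : PowerPartialIsometry.IsInner Θ)
    (hsum : ∀ z ∈ Metric.ball (0 : ℂ) 1,
      HasSum (fun m : ℕ => z ^ (m + 1) • θ (m + 1)) (Θ z))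
    (hθ : ∀ m : ℕ, 1 ≤ m → PowerPartialIsometry.IsPartialIsometry (θ m)) :
    ∃ _ : CompleteSpace (PowerPartialIsometry.modelSpace Θ hinner),
      ∃ T : PowerPartialIsometry.modelSpace Θ hinner →L[ℂ]
          PowerPartialIsometry.modelSpace Θ hinner,
        (∀ u : PowerPartialIsometry.modelSpace Θ hinner,
          ∀ᵐ t ∂PowerPartialIsometry.σ,
            PowerPartialIsometry.boundary
                (ContinuousLinearMap.adjoint T u : PowerPartialIsometry.HardySpace F) t =
              fourier (-1) t • (PowerPartialIsometry.boundary
                (u : PowerPartialIsometry.HardySpace F) t -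
                  (u : PowerPartialIsometry.HardySpace F) 0)) ∧
        PowerPartialIsometry.IsPure T ∧
        PowerPartialIsometry.IsPowerPartialIsometry T ∧
        ∃ hT : ‖T‖ ≤ 1,
          PowerPartialIsometry.Coincide (E := PowerPartialIsometry.defectSpace T)
            (F := PowerPartialIsometry.defectSpace (ContinuousLinearMap.adjoint T))
            (PowerPartialIsometry.charFun T hT) Θ := by
  open PowerPartialIsometry in
  have hθ' : ∀ m, IsPartialIsometry (θ (m + 1)) := fun m => hθ _ (Nat.succ_pos m)
  have hle : ∀ m a, ‖θ (m + 1) a‖ ≤ ‖a‖ := fun m => (hθ' m).norm_apply_le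
  -- The index shift matches the convention that the `m`-th coefficient belongs to `zᵐ⁺¹`; it
  -- encodes `Θ(0) = 0`.
  have hM : IsIsometricMultiplication (toeplitz (boundaryValue Θ) hinner.isBoundedSymbol)
      fun m => θ (m + 1) :=
    { norm_map := norm_toeplitz hinner hsum hle
      single_apply_add := fun n a => (toeplitz_single_apply hinner hsum hle n a).1
      single_apply_of_lt := fun n a => (toeplitz_single_apply hinner hsum hle n a).2 }
  have hK : ∀ u, u ∈ modelSpace Θ hinner ↔ ContinuousLinearMap.adjoint
      (toeplitz (boundaryValue Θ) hinner.isBoundedSymbol) u = 0 := hM.mem_range_one_sub_iff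
  have hc : IsClosed (modelSpace Θ hinner : Set (HardySpace F)) := by
    have : (modelSpace Θ hinner : Set (HardySpace F)) = {u | ContinuousLinearMap.adjoint
        (toeplitz (boundaryValue Θ) hinner.isBoundedSymbol) u = 0} := Set.ext hK
    rw [this]
    exact isClosed_eq (ContinuousLinearMap.continuous _) continuous_const
  have hcomplete : CompleteSpace (modelSpace Θ hinner) := hc.completeSpace_coe
  have hshift : ∀ u ∈ modelSpace Θ hinner, backwardShift u ∈ modelSpace Θ hinner := fun u hu =>
    (hK _).2 (hM.adjoint_backwardShift_eq_zero ((hK _).1 hu))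
  have hdrop : ∀ n, ∀ u ∈ modelSpace Θ hinner, dropLow n u ∈ modelSpace Θ hinner :=
    fun n u hu => (hK _).2 (hM.adjoint_dropLow_eq_zero hθ' n ((hK _).1 hu))
  have hT : ∀ u : modelSpace Θ hinner, (ContinuousLinearMap.adjoint (ContinuousLinearMap.adjoint
      (restrictedShift (modelSpace Θ hinner) hshift)) u : HardySpace F) = backwardShift u := by
    intro u
    rw [ContinuousLinearMap.adjoint_adjoint]
    rfl
  refine ⟨hcomplete, ContinuousLinearMap.adjoint (restrictedShift _ hshift), fun u => ?_,
    isPure_of_adjoint_eq_backwardShift hT,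
    isPowerPartialIsometry_of_adjoint_eq_backwardShift hT hdrop,
    norm_le_one_of_adjoint_eq_backwardShift hT,
    coincide_charFun hT hdrop hM hK hsum _⟩
  rw [hT]
  exact boundary_backwardShift_ae _
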